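/- The model is the word RAM with $w$-bit words: one time step per instruction (addition, subtraction, multiplication, division, remainder, bitwise operations, shifts, most significant bit, comparisons and jumps, reading $w$ consecutive bits of the stored bit string, reading and writing a word of working memory); a call to another data structure costs one step plus the time of that structure. Write $\lg=\log_2$. There are an absolute constant $C$ and two fixed query programs $P$ and $Q$ such that the following holds. Let $\pi$ be a permutation on $n$ elements $\{0,\dots,n-1\}$, and let $t$ be an integer with $1\le t\le n$. Then there is a succinct index for $\pi$ (a bit string, depending only on $n$, $t$ and $\pi$) of at most $C\,(n/t)\lg n$ bits with the following property. Let $w$ be any word size such that $n<2^w$ and every bit position of the index fits in a word, and let $D$ be any data structure that stores $\pi$ and supports queries $\pi()$ in time $g(\pi)$ on the machine with $w$-bit words. Then, for all $i\in\{0,\dots,n-1\}$ and all integers $0\le k<2^w$, the program $P$, given $i,k,n,t$, the index and the ability to call $D$, computes $\pi^k(i)$ in at most $C\,t\,g(\pi)$ time, and $Q$ likewise computes $\pi^{-k}(i)$ in at most $C\,t\,g(\pi)$ time. That is, the index takes $O((n/t)\lg n)$ bits and, when used in conjunction with $D$, supports $\pi^k()$ and $\pi^{-k}()$ queries in $O(t\,g(\pi))$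 time. -/

import Mathlib

/-! A word RAM with `w`-bit words, a read-only bit memory holding a static data structure,
and unit-cost instructions; data structures on it, and subroutine calls to a data structure. -/

namespace WordRAM

/-- The binary arithmetic and bitwise operations on words. -/
inductive Op where
  | add | sub | mul | div | mod | and | or | xor | shl | shr

/-- Evaluation of a binary operation on `w`-bit words, which are the natural numbers
below `2 ^ w`: the result is reduced modulo `2 ^ w` (division by zero gives zero). -/
def Op.eval (w : ℕ) : Op → ℕ → ℕ → ℕ
  | .add, a, b => (a + b) % 2 ^ w
  | .sub, a, b => (a + (2 ^ w - b % 2 ^ w)) % 2 ^ w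
  | .mul, a, b => (a * b) % 2 ^ w
  | .div, a, b => (a / b) % 2 ^ w
  | .mod, a, b => (a % b) % 2 ^ w
  | .and, a, b => (a &&& b) % 2 ^ w
  | .or, a, b => (a ||| b) % 2 ^ w
  | .xor, a, b => (a ^^^ b) % 2 ^ w
  | .shl, a, b => (a <<< b) % 2 ^ w
  | .shr, a, b => (a >>> b) % 2 ^ w

/-- The instructions. The operands are register numbers, apart from the numeral `c` in `const`
and the jump targets `l`, which are positions in the program. -/
inductive Instr where
  /-- `reg d := c` -/
  | const (d c : ℕ)
  /-- `reg d := o (reg a) (reg b)` -/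
  | op (o : Op) (d a b : ℕ)
  /-- `reg d :=` the position of the most significant one bit of `reg a` -/
  | msb (d a : ℕ)
  /-- `reg d :=` the word formed by `w` consecutive bits of the read-only bit memory,
  from bit number `reg p` on -/
  | read (d p : ℕ)
  /-- `reg d := mem (reg a)`, from the writable working memory -/
  | load (d a : ℕ)
  /-- `mem (reg a) := reg s` -/
  | store (a s : ℕ)
  /-- jump to `l` -/
  | jump (l : ℕ)
  /-- jump to `l` if `reg a < reg b` -/
  | jlt (a b l : ℕ)
  /-- jump to `l` if `reg a = reg b` -/
  | jeq (a b l : ℕ)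
  /-- `reg d :=` the answer of the data structure that can be called, to the query `reg a` -/
  | call (d a : ℕ)
  /-- stop with the output `reg a` -/
  | halt (a : ℕ)

/-- A program is a finite list of instructions. -/
abbrev Program := List Instr

/-- A configuration: program counter, registers, writable working memory. -/
structure Config where
  pc : ℕ
  reg : ℕ → ℕ
  mem : ℕ → ℕ

/-- Proceed to the next instruction after putting `v` into register `d`. -/
def Config.assign (c : Config) (d v : ℕ) : Config :=
  ⟨c.pc + 1, Function.update c.reg d v, c.mem⟩

/-- The initial configuration: the arguments are in the first registers, and all other registers
and all of the working memory are zero. -/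
def init (args : List ℕ) : Config :=
  ⟨0, fun r => args.getD r 0, fun _ => 0⟩

/-- The `w`-bit word at bit position `p` of the bit memory, least significant bit first;
bits past the end are zero. -/
def wordAt (w : ℕ) (bits : List Bool) (p : ℕ) : ℕ :=
  Nat.ofBits fun j : Fin w => bits.getD (p + j) false

/-- The effect of the instructions other than `call` and `halt`. -/
def exec (w : ℕ) (bits : List Bool) (c : Config) : Instr → Option Config
  | .const d v => some (c.assign d (v % 2 ^ w))
  | .op o d a b => some (c.assign d (o.eval w (c.reg a) (c.reg b)))
  | .msb d a => some (c.assign d (Nat.log 2 (c.reg a) % 2 ^ w))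
  | .read d p => some (c.assign d (wordAt w bits (c.reg p)))
  | .load d a => some (c.assign d (c.mem (c.reg a)))
  | .store a s => some ⟨c.pc + 1, c.reg, Function.update c.mem (c.reg a) (c.reg s)⟩
  | .jump l => some { c with pc := l }
  | .jlt a b l => some { c with pc := if c.reg a < c.reg b then l else c.pc + 1 }
  | .jeq a b l => some { c with pc := if c.reg a = c.reg b then l else c.pc + 1 }
  | .call _ _ => none
  | .halt _ => none

/-- `Runs w bits sub P c y T`: on the machine with `w`-bit words and bit memory `bits`, the
program `P`, started in configuration `c`, halts with output `y` after exactly `T` time steps.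
Here `sub x z s` says that the data structure that can be called answers `z` to the query `x`
in `s` steps. Every instruction takes one step, and a call takes in addition the steps
of the called data structure. -/
inductive Runs (w : ℕ) (bits : List Bool) (sub : ℕ → ℕ → ℕ → Prop) (P : Program) :
    Config → ℕ → ℕ → Prop where
  | halt (c : Config) (a : ℕ) (h : P[c.pc]? = some (.halt a)) :
      Runs w bits sub P c (c.reg a) 1
  | step (c c' : Config) (ins : Instr) (y T : ℕ) (h : P[c.pc]? = some ins)
      (he : exec w bits c ins = some c') (hr : Runs w bits sub P c' y T) :
      Runs w bits sub P c y (T + 1)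
  | call (c : Config) (d a z s y T : ℕ) (h : P[c.pc]? = some (.call d a))
      (hs : sub (c.reg a) z s) (hr : Runs w bits sub P (c.assign d z) y T) :
      Runs w bits sub P c y (s + T + 1)

/-- A static data structure: the bits stored, and the program that answers queries. -/
structure DataStructure where
  bits : List Bool
  prog : Program

/-- The data structure `D` answers `z` to the query `x` in `s` steps on the machine with
`w`-bit words (with its own bit memory, registers and working memory, and without calls). -/
def DataStructure.Answers (D : DataStructure) (w x z s : ℕ) : Prop :=
  Runs w D.bits (fun _ _ _ => False) D.prog (init [x]) z s

/-- `D` stores the permutation `π` of `{0, …, n - 1}` and supports queries `π()` in time `g`. -/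
def DataStructure.SupportsPerm (D : DataStructure) (w : ℕ) {n : ℕ} (π : Equiv.Perm (Fin n))
    (g : ℕ) : Prop :=
  ∀ x : Fin n, ∃ s ≤ g, D.Answers w x (π x) s

/-- The program `P`, with the index `I` in the bit memory and used in conjunction with `D`
(which it can call), answers `y` on the arguments `args` in time at most `B`. -/
def AnswersWith (P : Program) (w : ℕ) (I : List Bool) (D : DataStructure) (args : List ℕ)
    (y B : ℕ) : Prop :=
  ∃ T ≤ B, Runs w I (D.Answers w) P (init args) y T

end WordRAM

/-! Cut `{0, …, n - 1}` into blocks of `t` consecutive numbers, and every cycle of length at least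
`t` into segments of `t` consecutive elements, dropping an incomplete last piece. Any `k` segments
contain `k * t` elements and a block holds at most `t` of them, so they meet at least `k` blocks.
Hall's theorem therefore picks one element from every segment, no two in the same block
(`exists_injective_color_of_disjoint`, `exists_marks`). These elements are marked. As a block has at
most one mark, a table indexed by blocks stores the marks, and `x` is tested by comparing it with
entry `x / t`; no dictionary is needed.

Beside each mark, the index keeps its position on its cycle, the cycle length, and the place in one
further table where every `t`-th element of that cycle is listed (`exists_tables`). That makes `O(n
/ t)` rows of five entries of about `lg n` bits each.

To answer a query, apply `π` from `i` until a mark appears or the walk returns to `i`; one of the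
two happens within `3 * t` steps. After a return the cycle length is known, and the exponent reduced
modulo it is walked off directly (`Query.answers_short`). At a mark, arithmetic modulo the cycle
length gives the position of the answer; the last listed element at or before it is fetched, and
fewer than `t` further steps remain (`Query.answers_long`). A negative power differs only in how the
exponent is reduced. -/

open Function

/-! ### Distinct representatives -/

/-- Hall's theorem for colourings: from disjoint sets of size `t` one can pick representatives
of distinct colours if no colour is used more than `t` times. -/
theorem exists_injective_color_of_disjoint {ι α β : Type*} [DecidableEq α] [DecidableEq β]
    [Fintype α] (A : ι → Finset α) (c : α → β) {t : ℕ} (ht : 0 < t)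
    (hdisj : ∀ i j, i ≠ j → Disjoint (A i) (A j)) (hcard : ∀ i, (A i).card = t)
    (hc : ∀ b, (Finset.univ.filter fun x => c x = b).card ≤ t) :
    ∃ m : ι → α, (∀ i, m i ∈ A i) ∧ Injective fun i => c (m i) := by
  obtain ⟨f, hf, hfA⟩ := (Finset.all_card_le_biUnion_card_iff_exists_injective
    fun i => (A i).image c).1 (by
      intro s
      have h1 : (s.biUnion A).card = s.card * t := by
        rw [Finset.card_biUnion fun i _ j _ hij => hdisj i j hij]
        simp [hcard]
      have h2 : (s.biUnion A).card ≤ t * (s.biUnion fun i => (A i).image c).card := by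
        apply Finset.card_le_mul_card_image_of_maps_to (f := c)
        · intro x hx
          simp only [Finset.mem_biUnion, Finset.mem_image] at hx ⊢
          obtain ⟨i, hi, hx⟩ := hx
          exact ⟨i, hi, x, hx, rfl⟩
        · intro b _
          exact (Finset.card_le_card (Finset.filter_subset_filter _ (Finset.subset_univ _))).trans
            (hc b)
      rw [h1, mul_comm] at h2
      exact Nat.le_of_mul_le_mul_left h2 ht)
  simp only [Finset.mem_image] at hfA
  choose m hm hmf using hfA
  exact ⟨m, hm, by simpa only [hmf] using hf⟩

/-! ### Positions along the cycles of a permutation -/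

namespace Equiv.Perm

variable {α : Type*} (π : Perm α)

/-- A starting point on every cycle, and the distances from it. -/
structure CycleCoords where
  rep : α → α
  pos : α → ℕ
  rep_apply : ∀ x, rep (π x) = rep x
  iterate_pos : ∀ x, π^[pos x] (rep x) = x
  pos_lt : ∀ x, pos x < minimalPeriod π x

theorem minimalPeriod_pos [Finite α] (x : α) : 0 < minimalPeriod π x :=
  minimalPeriod_pos_of_mem_periodicPts (π.injective.mem_periodicPts x)

theorem minimalPeriod_iterate [Finite α] (x : α) (j : ℕ) :
    minimalPeriod π (π^[j] x) = minimalPeriod π x :=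
  minimalPeriod_apply_iterate (π.injective.mem_periodicPts x) j

theorem nonempty_cycleCoords [Finite α] : Nonempty π.CycleCoords := by
  let rep : α → α := fun x => (Quotient.mk (SameCycle.setoid π) x).out
  have hrep : ∀ x, SameCycle π (rep x) x := fun x => Quotient.mk_out (s := SameCycle.setoid π) x
  have hex : ∀ x, ∃ p < minimalPeriod π x, π^[p] (rep x) = x := by
    intro x
    obtain ⟨i, hi⟩ := (hrep x).exists_nat_pow_eq
    rw [← iterate_eq_pow] at hi
    have hm : minimalPeriod π (rep x) = minimalPeriod π x := by
      rw [← π.minimalPeriod_iterate (rep x) i, hi]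
    refine ⟨i % minimalPeriod π x, Nat.mod_lt _ (π.minimalPeriod_pos x), ?_⟩
    rw [← hm, iterate_mod_minimalPeriod_eq, hi]
  choose pos hlt hpos using hex
  refine ⟨⟨rep, pos, fun x => ?_, hpos, hlt⟩⟩
  have : Quotient.mk (SameCycle.setoid π) (π x) = Quotient.mk (SameCycle.setoid π) x :=
    Quotient.sound (s := SameCycle.setoid π) (sameCycle_apply_left.2 (SameCycle.refl π x))
  simp only [rep, this]

namespace CycleCoords

variable {π} (C : π.CycleCoords)

theorem rep_iterate (x : α) (j : ℕ) : C.rep (π^[j] x) = C.rep x := by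
  induction j with
  | zero => rfl
  | succ j ih => rw [iterate_succ_apply', C.rep_apply, ih]

theorem rep_rep (x : α) : C.rep (C.rep x) = C.rep x := by
  conv_rhs => rw [← C.iterate_pos x, C.rep_iterate]

/-- The fibres of `rep` are disjoint, and the fibre over a starting point contains its whole orbit.
This bounds the number of segments of all cycles together. -/
theorem sum_minimalPeriod_le [Fintype α] [DecidableEq α] :
    ∑ y with C.rep y = y, minimalPeriod π y ≤ Fintype.card α := by
  rw [← Finset.card_univ, Finset.card_eq_sum_card_fiberwise (f := C.rep)
    (t := Finset.univ.filter fun y => C.rep y = y)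
    (fun x _ => by simp [C.rep_rep])]
  refine Finset.sum_le_sum fun y hy => ?_
  have hy : C.rep y = y := by simpa using hy
  have hinj : Set.InjOn (fun j => π^[j] y) (Finset.range (minimalPeriod π y)) := by
    intro a ha b hb hab
    simp only [Finset.coe_range, Set.mem_Iio] at ha hb
    exact (iterate_eq_iterate_iff_of_lt_minimalPeriod ha hb).1 hab
  calc minimalPeriod π y = ((Finset.range (minimalPeriod π y)).image fun j => π^[j] y).card := by
        rw [Finset.card_image_of_injOn hinj, Finset.card_range]
    _ ≤ _ := Finset.card_le_card fun z hz => by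
        obtain ⟨j, _, rfl⟩ := Finset.mem_image.1 hz
        simp [C.rep_iterate, hy]

variable [Finite α]

theorem minimalPeriod_rep (x : α) : minimalPeriod π (C.rep x) = minimalPeriod π x := by
  conv_rhs => rw [← C.iterate_pos x, minimalPeriod_iterate]

/-- Both sides are exponents below the period that carry the starting point to the same element,
hence they are equal. -/
theorem pos_iterate (x : α) (j : ℕ) : C.pos (π^[j] x) = (C.pos x + j) % minimalPeriod π x := by
  have h : π^[C.pos (π^[j] x)] (C.rep x) = π^[(C.pos x + j) % minimalPeriod π x] (C.rep x) := by
    rw [← C.minimalPeriod_rep x, iterate_mod_minimalPeriod_eq, add_comm, iterate_add_apply,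
      C.iterate_pos]
    conv_rhs => rw [← C.iterate_pos (π^[j] x), C.rep_iterate]
  refine (iterate_eq_iterate_iff_of_lt_minimalPeriod ?_ ?_).1 h
  · rw [C.minimalPeriod_rep, ← π.minimalPeriod_iterate x j]
    exact C.pos_lt _
  · rw [C.minimalPeriod_rep]
    exact Nat.mod_lt _ (π.minimalPeriod_pos x)

end CycleCoords

/-! ### Choice of the marks -/

/-- One can mark elements of distinct colours so that every long cycle has a mark within
distance `3 * t` from each of its elements, if no colour is used more than `t` times. -/
theorem exists_marks [Fintype α] [DecidableEq α] {β : Type*} [DecidableEq β] (c : α → β) {t : ℕ}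
    (ht : 0 < t) (hc : ∀ b, (Finset.univ.filter fun x => c x = b).card ≤ t) :
    ∃ M : Set α, M.InjOn c ∧ (∀ x ∈ M, t ≤ minimalPeriod π x) ∧
      ∀ x, t ≤ minimalPeriod π x → ∃ j ≤ 3 * t, π^[j] x ∈ M := by
  obtain ⟨C⟩ := π.nonempty_cycleCoords
  -- The first elements of the full segments; a last piece shorter than `t` is left out, so that
  -- positions do not wrap around inside a segment.
  let ι := {x : α // t ∣ C.pos x ∧ C.pos x + t ≤ minimalPeriod π x}
  have hpos : ∀ (x : ι) j, j < t → C.pos (π^[j] x.1) = C.pos x.1 + j := fun x j hj => by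
    have := x.2.2
    rw [C.pos_iterate, Nat.mod_eq_of_lt (by omega)]
  obtain ⟨m, hmA, hm⟩ := exists_injective_color_of_disjoint
    (fun x : ι => (Finset.range t).image fun j => π^[j] x.1) c ht (by
      intro x y hxy
      rw [Finset.disjoint_left]
      intro z hx hy
      obtain ⟨j, hj, rfl⟩ := Finset.mem_image.1 hx
      obtain ⟨j', hj', he⟩ := Finset.mem_image.1 hy
      simp only [Finset.mem_range] at hj hj' he
      apply hxy
      have h1 : C.pos x.1 = C.pos y.1 := by
        have h := hpos x j hj
        rw [← he, hpos y j' hj'] at h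
        obtain ⟨a, ha⟩ := x.2.1
        obtain ⟨b, hb⟩ := y.2.1
        have := congrArg (· / t) h
        simp only [ha, hb] at this ⊢
        rw [Nat.mul_add_div ht, Nat.mul_add_div ht, Nat.div_eq_of_lt hj,
          Nat.div_eq_of_lt hj'] at this
        simp only [add_zero] at this
        rw [this]
      have h2 : C.rep x.1 = C.rep y.1 := by
        rw [← C.rep_iterate x.1 j, ← he, C.rep_iterate]
      exact Subtype.ext (by rw [← C.iterate_pos x.1, ← C.iterate_pos y.1, h1, h2]))
    (by
      intro x
      rw [Finset.card_image_of_injOn, Finset.card_range]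
      intro a ha b hb hab
      simp only [Finset.coe_range, Set.mem_Iio] at ha hb
      have := x.2.2
      exact (iterate_eq_iterate_iff_of_lt_minimalPeriod (by omega) (by omega)).1 hab) hc
  refine ⟨Set.range m, ?_, ?_, ?_⟩
  · rintro _ ⟨x, rfl⟩ _ ⟨y, rfl⟩ h
    rw [hm h]
  · rintro _ ⟨x, rfl⟩
    obtain ⟨j, _, he⟩ := Finset.mem_image.1 (hmA x)
    rw [← he, minimalPeriod_iterate]
    have := x.2.2
    omega
  · intro x hx
    -- Go to the next multiple of `t` if a full segment starts there. Otherwise the end of the cycle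
    -- is less than `2 * t` away, and position 0 starts a full segment. The mark lies fewer than `t`
    -- steps further, which gives `3 * t`.
    obtain ⟨a, ha, h1, h2⟩ : ∃ a ≤ 2 * t, t ∣ C.pos (π^[a] x) ∧
        C.pos (π^[a] x) + t ≤ minimalPeriod π (π^[a] x) := by
      have hlt := C.pos_lt x
      have hdm := Nat.div_add_mod (C.pos x) t
      have hmod := Nat.mod_lt (C.pos x) ht
      simp only [C.pos_iterate, minimalPeriod_iterate]
      by_cases h : C.pos x + (t - C.pos x % t) + t ≤ minimalPeriod π x
      · refine ⟨t - C.pos x % t, by omega, ?_⟩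
        rw [Nat.mod_eq_of_lt (by omega)]
        refine ⟨⟨C.pos x / t + 1, ?_⟩, h⟩
        rw [mul_add]
        omega
      · refine ⟨minimalPeriod π x - C.pos x, by omega, ?_⟩
        rw [Nat.add_sub_cancel' hlt.le, Nat.mod_self]
        simpa using hx
    obtain ⟨j, hj, he⟩ := Finset.mem_image.1 (hmA ⟨π^[a] x, h1, h2⟩)
    rw [Finset.mem_range] at hj
    exact ⟨j + a, by omega, ⟨⟨π^[a] x, h1, h2⟩, by rw [iterate_add_apply, ← he]⟩⟩

end Equiv.Perm

/-! ### Contents of the index -/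

/-- Finite sequences of lengths `f 0`, `f 1`, … can be written one after the other. -/
theorem exists_concat {β : Type*} [Inhabited β] (f : ℕ → ℕ) (g : ℕ → ℕ → β) :
    ∃ h : ℕ → β, ∀ x s, s < f x → h (∑ y ∈ Finset.range x, f y + s) = g x s := by
  classical
  have hmono : ∀ x x' s s', s < f x → x < x' →
      ∑ y ∈ Finset.range x, f y + s < ∑ y ∈ Finset.range x', f y + s' := by
    intro x x' s s' hs hx
    have := Finset.sum_le_sum_of_subset (f := f) (Finset.range_mono (Nat.succ_le_of_lt hx))
    rw [Nat.succ_eq_add_one, Finset.sum_range_succ] at this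
    omega
  let S : ℕ → ℕ × ℕ → Prop := fun r p => p.2 < f p.1 ∧ ∑ y ∈ Finset.range p.1, f y + p.2 = r
  refine ⟨fun r => if h : ∃ p, S r p then g h.choose.1 h.choose.2 else default, fun x s hs => ?_⟩
  have hex : ∃ p, S (∑ y ∈ Finset.range x, f y + s) p := ⟨(x, s), hs, rfl⟩
  simp only [dif_pos hex]
  obtain ⟨h1, h2⟩ := hex.choose_spec
  rcases lt_trichotomy hex.choose.1 x with h | h | h
  · exact absurd h2 (hmono _ _ _ _ h1 h).ne
  · rw [h] at h2 ⊢
    rw [Nat.add_left_cancel h2]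
  · exact absurd h2 (hmono _ _ _ _ hs h).ne'

namespace Equiv.Perm

/-- The contents of the index: tables with entries at most `n` and with `2 * n / t + 1` rows. -/
theorem exists_tables {n t : ℕ} (π : Perm (Fin n)) (ht : 0 < t) :
    ∃ mark pos len base seg : ℕ → ℕ,
      (∀ r, mark r ≤ n ∧ pos r ≤ n ∧ len r ≤ n ∧ base r ≤ n ∧ seg r ≤ n) ∧
      ∀ i : Fin n, ∃ j ≤ 3 * t,
        (∀ j' < j, mark ((π^[j'] i : ℕ) / t) ≠ π^[j'] i) ∧
        (∀ j' < j, 0 < j' → π^[j'] i ≠ i) ∧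
        ((0 < j ∧ π^[j] i = i) ∨
          ((0 < j → π^[j] i ≠ i) ∧ ∃ r m l, (π^[j] i : ℕ) / t = r ∧ mark r = π^[j] i ∧
            pos r = m ∧ len r = l ∧ m < l ∧ j < l ∧ IsPeriodicPt π l i ∧
            ∀ q < l, base r + q / t < 2 * n / t + 1 ∧
              ∃ s : Fin n, seg (base r + q / t) = s ∧
                ∀ e, q + j ≡ m + e [MOD l] → π^[q % t] s = π^[e] i)) := by
  classical
  obtain ⟨C⟩ := π.nonempty_cycleCoords
  obtain ⟨M, hMinj, hMlong, hM⟩ := π.exists_marks (fun x : Fin n => (x : ℕ) / t) ht (by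
    intro b
    calc _ ≤ (Finset.Ico (b * t) (b * t + t)).card :=
          Finset.card_le_card_of_injOn Fin.val (fun x hx => by
            simp only [Finset.coe_filter, Finset.mem_univ, true_and, Set.mem_ofPred_eq] at hx
            have := Nat.mod_lt (x : ℕ) ht
            have := Nat.div_add_mod (x : ℕ) t
            rw [hx, mul_comm] at this
            simp only [Finset.coe_Ico, Set.mem_Ico]
            omega) Fin.val_injective.injOn
      _ = t := by simp)
  let L : Fin n → ℕ := fun x => minimalPeriod π x
  have hLn : ∀ x, L x ≤ n := fun x => (minimalPeriod_le_card).trans (Fintype.card_fin n).le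
  -- The number `⌈L / t⌉` of listed elements, counted once for each long cycle, at its starting
  -- point. It is at most `L`, so offsets fit in an entry, and at most `2 * L / t` since `t ≤ L`,
  -- which bounds the number of rows.
  let f' : Fin n → ℕ := fun y => if C.rep y = y ∧ t ≤ L y then (L y + t - 1) / t else 0
  let f : ℕ → ℕ := fun y => if h : y < n then f' ⟨y, h⟩ else 0
  let S : ℕ → ℕ := fun x => ∑ y ∈ Finset.range x, f y
  have hSn : S n = ∑ y, f' y := by
    simp only [S]
    rw [← Fin.sum_univ_eq_sum_range]
    exact Finset.sum_congr rfl fun y _ => by simp [f]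
  have hS1 : S n ≤ n := by
    rw [hSn]
    calc ∑ y, f' y ≤ ∑ y, if C.rep y = y then L y else 0 := Finset.sum_le_sum fun y _ => by
          simp only [f']
          by_cases h : C.rep y = y ∧ t ≤ L y
          · rw [if_pos h, if_pos h.1, Nat.div_le_iff_le_mul ht]
            have := Nat.le_mul_of_pos_right (L y) ht
            omega
          · rw [if_neg h]; exact Nat.zero_le _
      _ ≤ n := by
          rw [← Finset.sum_filter]
          exact C.sum_minimalPeriod_le.trans (Fintype.card_fin n).le
  have hS2 : S n ≤ 2 * n / t := by
    rw [Nat.le_div_iff_mul_le ht, hSn, Finset.sum_mul]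
    calc ∑ y, f' y * t ≤ ∑ y, 2 * if C.rep y = y then L y else 0 := Finset.sum_le_sum fun y _ => by
          simp only [f']
          by_cases h : C.rep y = y ∧ t ≤ L y
          · rw [if_pos h, if_pos h.1]
            have := Nat.div_mul_le_self (L y + t - 1) t
            omega
          · rw [if_neg h]; simp
      _ ≤ 2 * n := by
          rw [← Finset.mul_sum, ← Finset.sum_filter]
          exact Nat.mul_le_mul_left 2 (C.sum_minimalPeriod_le.trans (Fintype.card_fin n).le)
  have hSmono : Monotone S := fun a b hab => Finset.sum_le_sum_of_subset (Finset.range_mono hab)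
  -- `Fin (n + 1)` is inhabited even for `n = 0`, and it keeps every entry, including the unused
  -- ones, at most `n`.
  obtain ⟨seg, hseg⟩ := exists_concat (β := Fin (n + 1)) f fun y s =>
    if h : y < n then (π^[s * t] ⟨y, h⟩).castSucc else 0
  -- Blocks without a mark get the default `n`, which is not an element and so never passes the test
  -- for a mark.
  let row : (Fin n → ℕ) → ℕ → ℕ := fun g r =>
    if h : ∃ x ∈ M, (x : ℕ) / t = r then g h.choose else n
  have hrow : ∀ g, (∀ x, g x ≤ n) → ∀ r, row g r ≤ n := by
    intro g hg r
    simp only [row]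
    split_ifs
    · exact hg _
    · exact le_rfl
  have hrowM : ∀ g, ∀ x ∈ M, row g ((x : ℕ) / t) = g x := by
    intro g x hx
    have hex : ∃ y ∈ M, (y : ℕ) / t = (x : ℕ) / t := ⟨x, hx, rfl⟩
    simp only [row, dif_pos hex]
    rw [hMinj hex.choose_spec.1 hx hex.choose_spec.2]
  have hmark : ∀ x : Fin n, row Fin.val ((x : ℕ) / t) = x ↔ x ∈ M := by
    intro x
    refine ⟨fun h => ?_, hrowM _ x⟩
    by_cases hex : ∃ y ∈ M, (y : ℕ) / t = (x : ℕ) / t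
    · simp only [row, dif_pos hex] at h
      rw [← Fin.ext h]
      exact hex.choose_spec.1
    · simp only [row, dif_neg hex] at h
      exact absurd h x.2.ne'
  refine ⟨row Fin.val, row C.pos, row L, row fun x => S (C.rep x), fun r => seg r, fun r =>
    ⟨hrow _ (fun x => x.2.le) r, hrow _ (fun x => ((C.pos_lt x).trans_le (hLn x)).le) r,
      hrow _ hLn r, hrow _ (fun x => (hSmono (C.rep x).2.le).trans hS1) r,
      Nat.le_of_lt_succ (seg r).2⟩, fun i => ?_⟩
  let p : ℕ → Prop := fun j => π^[j] i ∈ M ∨ (0 < j ∧ π^[j] i = i)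
  have hex : ∃ j ≤ 3 * t, p j := by
    by_cases h : t ≤ L i
    · obtain ⟨j, hj, h⟩ := hM i h
      exact ⟨j, hj, Or.inl h⟩
    · exact ⟨L i, by omega, Or.inr ⟨π.minimalPeriod_pos i, iterate_minimalPeriod⟩⟩
  obtain ⟨j₀, hj₀, hp₀⟩ := hex
  have hex : ∃ j, p j := ⟨j₀, hp₀⟩
  have hmin : ∀ j' < Nat.find hex, π^[j'] i ∉ M ∧ (0 < j' → π^[j'] i ≠ i) := by
    intro j' hj'
    have := Nat.find_min hex hj'
    simp only [p] at this
    tauto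
  have hle := (Nat.find_min' hex hp₀).trans hj₀
  have hspec := Nat.find_spec hex
  generalize Nat.find hex = j at *
  refine ⟨j, hle, fun j' h => (hmark _).not.2 (hmin j' h).1, fun j' h => (hmin j' h).2, ?_⟩
  by_cases hc : 0 < j ∧ π^[j] i = i
  · exact Or.inl hc
  · right
    have hjM : π^[j] i ∈ M := hspec.resolve_right hc
    have hjL : j < L i := by
      by_contra hge
      rcases (not_lt.1 hge).eq_or_lt with h | h
      · exact hc ⟨h ▸ π.minimalPeriod_pos i, h ▸ iterate_minimalPeriod⟩
      · exact (hmin _ h).2 (π.minimalPeriod_pos i) iterate_minimalPeriod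
    have hLj : L (π^[j] i) = L i := π.minimalPeriod_iterate i j
    refine ⟨fun h0 h => hc ⟨h0, h⟩, _, C.pos (π^[j] i), L i, rfl, (hmark _).2 hjM,
      hrowM _ _ hjM, (hrowM _ _ hjM).trans hLj, (C.pos_lt _).trans_eq hLj, hjL,
      isPeriodicPt_minimalPeriod _ _, fun q hq => ?_⟩
    have hbase := hrowM (fun x => S (C.rep x)) _ hjM
    simp only [hbase]
    have htL : t ≤ L i := (hMlong _ hjM).trans_eq hLj
    have hpos := C.iterate_pos (π^[j] i)
    set c := C.rep (π^[j] i) with hcdef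
    have hLc : L c = L i := (C.minimalPeriod_rep _).trans hLj
    have hqf : q / t < f c := by
      have hfc : f c = (L i + t - 1) / t := by
        simp only [f, dif_pos c.2, f']
        rw [if_pos ⟨C.rep_rep _, hLc ▸ htL⟩, hLc]
      rw [hfc, ← Nat.add_one_le_iff, ← Nat.add_div_right q ht]
      exact Nat.div_le_div_right (by omega)
    constructor
    · have h1 : S (c + 1) = S c + f c := Finset.sum_range_succ _ _
      have h2 := (hSmono (Nat.succ_le_of_lt c.2)).trans hS2
      rw [Nat.succ_eq_add_one, h1] at h2
      show S c + _ < _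
      omega
    · refine ⟨π^[q / t * t] c, ?_, fun e he => ?_⟩
      · show (seg (∑ y ∈ Finset.range c, f y + q / t) : ℕ) = _
        rw [hseg _ _ hqf, dif_pos c.2]
        rfl
      · rw [← iterate_add_apply, mul_comm, Nat.mod_add_div]
        -- Only the mark `π^[j] i` has a recorded position. Pushing both sides forward by `j` turns
        -- them into iterates of the starting point `c`, where the congruence modulo the cycle
        -- length applies.
        apply π.injective.iterate j
        rw [← iterate_add_apply, add_comm j q, ← iterate_mod_minimalPeriod_eq]
        change π^[(q + j) % L c] c = _
        rw [hLc, he, ← hLc, iterate_mod_minimalPeriod_eq, add_comm, iterate_add_apply, hpos,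
          ← iterate_add_apply, ← iterate_add_apply, add_comm]

end Equiv.Perm

/-! ### Time-bounded runs and word arithmetic -/

namespace WordRAM

/-- Some run of `P` from `c` halts with output `y` after at most `B` steps. -/
def RunsWithin (w : ℕ) (bits : List Bool) (sub : ℕ → ℕ → ℕ → Prop) (P : Program) (c : Config)
    (y B : ℕ) : Prop :=
  ∃ T ≤ B, Runs w bits sub P c y T

namespace RunsWithin

variable {w : ℕ} {bits : List Bool} {sub : ℕ → ℕ → ℕ → Prop} {P : Program} {pc y B : ℕ}
  {reg mem : ℕ → ℕ}

theorem mono {c : Config} {B' : ℕ} (h : RunsWithin w bits sub P c y B) (hB : B ≤ B') :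
    RunsWithin w bits sub P c y B' :=
  let ⟨T, hT, hr⟩ := h
  ⟨T, hT.trans hB, hr⟩

theorem step {c c' : Config} {ins : Instr} (h : P[c.pc]? = some ins)
    (he : exec w bits c ins = some c') (hr : RunsWithin w bits sub P c' y B) :
    RunsWithin w bits sub P c y (B + 1) :=
  let ⟨T, hT, hr⟩ := hr
  ⟨T + 1, Nat.add_le_add_right hT 1, .step _ _ _ _ _ h he hr⟩

theorem const {d v : ℕ} (h : P[pc]? = some (.const d v))
    (hr : RunsWithin w bits sub P ⟨pc + 1, update reg d (v % 2 ^ w), mem⟩ y B) :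
    RunsWithin w bits sub P ⟨pc, reg, mem⟩ y (B + 1) :=
  step h rfl hr

theorem op {o : Op} {d a b : ℕ} (h : P[pc]? = some (.op o d a b))
    (hr : RunsWithin w bits sub P ⟨pc + 1, update reg d (o.eval w (reg a) (reg b)), mem⟩ y B) :
    RunsWithin w bits sub P ⟨pc, reg, mem⟩ y (B + 1) :=
  step h rfl hr

theorem msb {d a : ℕ} (h : P[pc]? = some (.msb d a))
    (hr : RunsWithin w bits sub P
      ⟨pc + 1, update reg d (Nat.log 2 (reg a) % 2 ^ w), mem⟩ y B) :
    RunsWithin w bits sub P ⟨pc, reg, mem⟩ y (B + 1) :=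
  step h rfl hr

theorem read {d p : ℕ} (h : P[pc]? = some (.read d p))
    (hr : RunsWithin w bits sub P ⟨pc + 1, update reg d (wordAt w bits (reg p)), mem⟩ y B) :
    RunsWithin w bits sub P ⟨pc, reg, mem⟩ y (B + 1) :=
  step h rfl hr

theorem jump {l : ℕ} (h : P[pc]? = some (.jump l))
    (hr : RunsWithin w bits sub P ⟨l, reg, mem⟩ y B) :
    RunsWithin w bits sub P ⟨pc, reg, mem⟩ y (B + 1) :=
  step h rfl hr

theorem jlt_pos {a b l : ℕ} (h : P[pc]? = some (.jlt a b l)) (hlt : reg a < reg b)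
    (hr : RunsWithin w bits sub P ⟨l, reg, mem⟩ y B) :
    RunsWithin w bits sub P ⟨pc, reg, mem⟩ y (B + 1) :=
  step h (by simp [exec, hlt]) hr

theorem jlt_neg {a b l : ℕ} (h : P[pc]? = some (.jlt a b l)) (hlt : ¬ reg a < reg b)
    (hr : RunsWithin w bits sub P ⟨pc + 1, reg, mem⟩ y B) :
    RunsWithin w bits sub P ⟨pc, reg, mem⟩ y (B + 1) :=
  step h (by simp only [exec, if_neg hlt]) hr

theorem jeq_pos {a b l : ℕ} (h : P[pc]? = some (.jeq a b l)) (heq : reg a = reg b)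
    (hr : RunsWithin w bits sub P ⟨l, reg, mem⟩ y B) :
    RunsWithin w bits sub P ⟨pc, reg, mem⟩ y (B + 1) :=
  step h (by simp [exec, heq]) hr

theorem jeq_neg {a b l : ℕ} (h : P[pc]? = some (.jeq a b l)) (heq : reg a ≠ reg b)
    (hr : RunsWithin w bits sub P ⟨pc + 1, reg, mem⟩ y B) :
    RunsWithin w bits sub P ⟨pc, reg, mem⟩ y (B + 1) :=
  step h (by simp only [exec, if_neg heq]) hr

theorem halt {a : ℕ} (h : P[pc]? = some (.halt a)) (hy : reg a = y) :
    RunsWithin w bits sub P ⟨pc, reg, mem⟩ y 1 :=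
  ⟨1, le_rfl, hy ▸ Runs.halt (⟨pc, reg, mem⟩ : Config) a h⟩

theorem call {d a x z g : ℕ} (h : P[pc]? = some (.call d a)) (hx : reg a = x)
    (hs : ∃ s ≤ g, sub x z s)
    (hr : RunsWithin w bits sub P ⟨pc + 1, update reg d z, mem⟩ y B) :
    RunsWithin w bits sub P ⟨pc, reg, mem⟩ y (B + g + 1) := by
  obtain ⟨s, hsg, hs⟩ := hs
  obtain ⟨T, hT, hr⟩ := hr
  subst hx
  exact ⟨s + T + 1, by omega, .call (⟨pc, reg, mem⟩ : Config) d a z s y T h hs hr⟩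

end RunsWithin

theorem Runs.pos {w : ℕ} {bits : List Bool} {sub : ℕ → ℕ → ℕ → Prop} {P : Program} {c : Config}
    {y T : ℕ} (h : Runs w bits sub P c y T) : 0 < T := by
  cases h <;> omega

theorem Op.eval_sub_of_le {w a b : ℕ} (hb : b ≤ a) (ha : a < 2 ^ w) :
    Op.sub.eval w a b = a - b := by
  rw [Op.eval, Nat.mod_eq_of_lt (hb.trans_lt ha),
    show a + (2 ^ w - b) = a - b + 2 ^ w by omega, Nat.add_mod_right, Nat.mod_eq_of_lt (by omega)]

theorem Op.eval_add_of_lt {w a b : ℕ} (h : a + b < 2 ^ w) : Op.add.eval w a b = a + b :=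
  Nat.mod_eq_of_lt h

/-! ### Packing the entries into bits -/

/-- The first `F` values of `T`, written one after the other with `L` bits each. -/
def encode (L F : ℕ) (T : ℕ → ℕ) : List Bool :=
  (List.range (F * L)).map fun p => (T (p / L)).testBit (p % L)

theorem length_encode (L F : ℕ) (T : ℕ → ℕ) : (encode L F T).length = F * L := by
  simp [encode]

theorem wordAt_encode {w L F f : ℕ} {T : ℕ → ℕ} (hL : L ≤ w) (hf : f < F) (hT : T f < 2 ^ L) :
    wordAt w (encode L F T) (f * L) % (2 ^ L % 2 ^ w) = T f := by
  have key : wordAt w (encode L F T) (f * L) % 2 ^ L = T f := by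
    apply Nat.eq_of_testBit_eq
    intro j
    rw [Nat.testBit_mod_two_pow]
    by_cases hj : j < L
    · have hlt : f * L + j < F * L := by nlinarith
      have hdiv : (f * L + j) / L = f := by
        rw [mul_comm, Nat.mul_add_div (by omega), Nat.div_eq_of_lt hj, add_zero]
      have hmod : (f * L + j) % L = j := by
        rw [mul_comm, Nat.mul_add_mod, Nat.mod_eq_of_lt hj]
      rw [wordAt, Nat.testBit_ofBits_lt _ _ (hj.trans_le hL)]
      simp [encode, hlt, hdiv, hmod, hj]
    · simp only [hj, decide_false, Bool.false_and]
      exact (Nat.testBit_lt_two_pow (hT.trans_le (Nat.pow_le_pow_right two_pos (not_lt.1 hj)))).symm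
  -- For `L = w` the modulus `2 ^ L` overflows to zero. A remainder modulo zero leaves the word
  -- unchanged, which is right because the word then is exactly the entry.
  rcases hL.eq_or_lt with rfl | h
  · rw [Nat.mod_self, Nat.mod_zero]
    rwa [Nat.mod_eq_of_lt (by exact Nat.ofBits_lt_two_pow _)] at key
  · rwa [Nat.mod_eq_of_lt (Nat.pow_lt_pow_right one_lt_two h)]

/-! ### The query programs -/

/-- The query program for `π ^ k`, or for `π ^ (-k)` if `neg`. The registers `0`, …, `3` hold
`i`, `k`, `n`, `t`; register `4` is the field width, `6` the current element, `7` the number of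
steps made from `i`, and `12` the number of steps still to be made. -/
def powerProgram (neg : Bool) : Program := [
  .const 8 1,
  .jlt 8 2 3,
  .halt 0,
  .msb 4 2,
  .op .add 4 4 8,
  .op .shl 5 8 4,
  .op .add 6 0 20,
  .const 10 5,
  -- 8: look for a marked element
  .op .div 9 6 3,
  .op .mul 9 9 10,
  .op .mul 9 9 4,
  .read 11 9,
  .op .mod 11 11 5,
  .jeq 11 6 25,
  .call 6 6,
  .op .add 7 7 8,
  .jeq 6 0 18,
  .jump 8,
  -- 18: the walk has gone round a short cycle
  .op .mod 12 1 7,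
  if neg then .op .sub 12 7 12 else .op .add 12 12 20,
  -- 20: walk to the answer
  .jeq 12 20 24,
  .call 6 6,
  .op .sub 12 12 8,
  .jump 20,
  .halt 6,
  -- 25: a marked element has been found, read its position and cycle
  .op .add 9 9 4,
  .read 13 9,
  .op .mod 13 13 5,
  .op .add 9 9 4,
  .read 14 9,
  .op .mod 14 14 5,
  .op .add 9 9 4,
  .read 15 9,
  .op .mod 15 15 5,
  .op .mod 12 1 14,
  if neg then .op .sub 12 14 12 else .op .add 12 12 20,
  -- 36: the position of `i`
  .jlt 13 7 39,
  .op .sub 13 13 7,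
  .jump 41,
  .op .sub 16 14 7,
  .op .add 13 13 16,
  -- 41: the position of the answer
  .op .sub 16 14 13,
  .jlt 12 16 45,
  .op .sub 12 12 16,
  .jump 46,
  .op .add 12 12 13,
  -- 46: go to the start of the segment of the answer
  .op .div 16 12 3,
  .op .mod 12 12 3,
  .op .add 16 16 15,
  .op .mul 16 16 10,
  .const 17 4,
  .op .add 16 16 17,
  .op .mul 16 16 4,
  .read 6 16,
  .op .mod 6 6 5,
  .jump 20]

/-- The number of forward steps that make `k` forward steps, or `k` backward steps if `neg`,
on a cycle of length `l`. -/
def reducedPower (neg : Bool) (k l : ℕ) : ℕ := if neg then l - k % l else k % l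

/-- Equality does occur, for `neg` with `l ∣ k`: the walk then makes one full turn, so later steps
must allow the exponent `l` itself. -/
theorem reducedPower_le {neg : Bool} {k l : ℕ} (hl : 0 < l) : reducedPower neg k l ≤ l := by
  have := Nat.mod_lt k hl
  unfold reducedPower
  split_ifs <;> omega

theorem iterate_reducedPower_false {n k l : ℕ} {π : Equiv.Perm (Fin n)} {i : Fin n}
    (h : IsPeriodicPt π l i) : π^[reducedPower false k l] i = (π ^ k) i := by
  rw [← Equiv.Perm.iterate_eq_pow]
  exact h.iterate_mod_apply k

theorem iterate_reducedPower_true {n k l : ℕ} {π : Equiv.Perm (Fin n)} {i : Fin n}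
    (hl : 0 < l) (h : IsPeriodicPt π l i) :
    π^[reducedPower true k l] i = (π ^ (-(k : ℤ))) i := by
  rw [zpow_neg, zpow_natCast, Equiv.Perm.eq_inv_iff_eq, ← Equiv.Perm.iterate_eq_pow,
    ← iterate_add_apply, ← h.iterate_mod_apply]
  have h1 := Nat.mod_lt k hl
  have h2 := Nat.div_add_mod k l
  have : k + reducedPower true k l = l * (k / l + 1) := by
    simp only [reducedPower, if_true]
    rw [mul_add]
    omega
  rw [this, Nat.mul_mod_right, iterate_zero_apply]

/-- The data of a query: `T` holds the fields of the index. -/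
structure Query (w n t k L F g : ℕ) (T : ℕ → ℕ) (π : Equiv.Perm (Fin n)) (D : DataStructure) :
    Prop where
  t_pos : 0 < t
  n_lt : n < 2 ^ w
  k_lt : k < 2 ^ w
  L_pos : 0 < L
  L_le : L ≤ w
  F_le : F * L ≤ 2 ^ w
  five_lt : 5 < 2 ^ w
  field_lt : ∀ f, T f < 2 ^ L
  row_lt : ∀ x < n, x / t * 5 + 4 < F
  supports : D.SupportsPerm w π g

/-- The contents of the registers that do not change during the search. -/
structure Ready (w k t L i : ℕ) (reg : ℕ → ℕ) : Prop where
  r0 : reg 0 = i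
  r1 : reg 1 = k
  r3 : reg 3 = t
  r4 : reg 4 = L
  r5 : reg 5 = 2 ^ L % 2 ^ w
  r8 : reg 8 = 1
  r10 : reg 10 = 5
  r20 : reg 20 = 0

theorem Ready.update {w k t L i d : ℕ} {reg : ℕ → ℕ} (h : Ready w k t L i reg) (v : ℕ)
    (hd : d ≠ 0 ∧ d ≠ 1 ∧ d ≠ 3 ∧ d ≠ 4 ∧ d ≠ 5 ∧ d ≠ 8 ∧ d ≠ 10 ∧ d ≠ 20) :
    Ready w k t L i (update reg d v) := by
  obtain ⟨h0, h1, h3, h4, h5, h8, h10, h20⟩ := hd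
  constructor <;> rw [update_of_ne (Ne.symm ‹_›)]
  exacts [h.r0, h.r1, h.r3, h.r4, h.r5, h.r8, h.r10, h.r20]

/-! ### Correctness and cost of the phases of a query -/

namespace Query

variable {w n t k L F g : ℕ} {T : ℕ → ℕ} {π : Equiv.Perm (Fin n)} {D : DataStructure}
  {neg : Bool} {reg mem : ℕ → ℕ} {y B : ℕ} {i : Fin n}

/-- Bounded runs of the query program on the encoded index. -/
local notation "Halts" => RunsWithin w (encode L F T) (D.Answers w) (powerProgram neg)

theorem address_lt (h : Query w n t k L F g T π D) {f : ℕ} (hf : f < F) : f * L < 2 ^ w :=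
  (Nat.mul_lt_mul_of_pos_right hf h.L_pos).trans_le h.F_le

theorem field (h : Query w n t k L F g T π D) {f : ℕ} (hf : f < F) :
    wordAt w (encode L F T) (f * L) % (2 ^ L % 2 ^ w) % 2 ^ w = T f := by
  rw [wordAt_encode h.L_le hf (h.field_lt f), Nat.mod_eq_of_lt]
  exact (h.field_lt f).trans_le (Nat.pow_le_pow_right two_pos h.L_le)

/-- One round costs `g + 4`: a test, a call, a decrement and a jump. The final test and `halt`
account for the 2. -/
theorem walk (h : Query w n t k L F g T π D) (m : ℕ) : ∀ (reg : ℕ → ℕ) (x : Fin n),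
    reg 6 = x → reg 8 = 1 → reg 12 = m → reg 20 = 0 → m < 2 ^ w →
    Halts ⟨20, reg, mem⟩ (π^[m] x : Fin n) (m * (g + 4) + 2) := by
  induction m with
  | zero =>
    intro reg x h6 h8 h12 h20 hm
    exact ((RunsWithin.halt rfl h6).jeq_pos rfl (h12.trans h20.symm)).mono (by omega)
  | succ m ih =>
    intro reg x h6 h8 h12 h20 hm
    have hstep : Halts ⟨20, reg, mem⟩ (π^[m + 1] x : Fin n) (m * (g + 4) + 2 + 1 + 1 + g + 1 + 1) := by
      refine .jeq_neg rfl (by omega) (.call rfl h6 (h.supports x) (.op rfl (.jump rfl ?_)))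
      rw [iterate_succ_apply]
      refine ih _ (π x) ?_ ?_ ?_ ?_ (by omega)
      · simp
      · simp [h8]
      · simp [h8, h12]
        rw [Op.eval_sub_of_le (by omega) hm, Nat.add_sub_cancel]
      · simp [h20]
    exact hstep.mono (by rw [add_mul]; omega)

theorem search_address (h : Query w n t k L F g T π D) (x : Fin n) :
    (x : ℕ) / t % 2 ^ w * 5 % 2 ^ w * L % 2 ^ w = x / t * 5 * L := by
  have := h.row_lt x x.2
  simp only [Nat.mod_mul_mod]
  exact Nat.mod_eq_of_lt (h.address_lt (by omega))

theorem search_mark (h : Query w n t k L F g T π D) (hr : Ready w k t L i reg) {x : Fin n}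
    (h6 : reg 6 = x) {j : ℕ} (h7 : reg 7 = j) (hx : T (x / t * 5) = x)
    (hB : ∀ reg', Ready w k t L i reg' → reg' 7 = j → reg' 9 = x / t * 5 * L →
      Halts ⟨25, reg', mem⟩ y B) :
    Halts ⟨8, reg, mem⟩ y (B + 6) := by
  have hrow := h.row_lt x x.2
  refine .op rfl (.op rfl (.op rfl (.read rfl (.op rfl (.jeq_pos rfl ?_ (hB _ ?_ ?_ ?_))))))
  · simp [Op.eval, hr.r3, hr.r4, hr.r5, hr.r10, h6, -Nat.mod_mul_mod, h.search_address x]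
    rw [h.field (by omega), hx]
  · exact ((((hr.update _ (by decide)).update _ (by decide)).update _ (by decide)).update _
      (by decide)).update _ (by decide)
  · simp [h7]
  · simp [Op.eval, hr.r3, hr.r4, hr.r10, h6, -Nat.mod_mul_mod, h.search_address x]

theorem search_next (h : Query w n t k L F g T π D) (hr : Ready w k t L i reg) {x : Fin n}
    (h6 : reg 6 = x) {j : ℕ} (h7 : reg 7 = j) (hx : T (x / t * 5) ≠ x) (hj : j + 1 < 2 ^ w)
    (hB : ∀ reg', Ready w k t L i reg' → reg' 6 = π x → reg' 7 = j + 1 →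
      Halts ⟨16, reg', mem⟩ y B) :
    Halts ⟨8, reg, mem⟩ y (B + 1 + g + 7) := by
  have hrow := h.row_lt x x.2
  refine .op rfl (.op rfl (.op rfl (.read rfl (.op rfl (.jeq_neg rfl ?_
    (.call rfl (x := x) ?_ (h.supports x) (.op rfl (hB _ ?_ ?_ ?_))))))))
  · simp [Op.eval, hr.r3, hr.r4, hr.r5, hr.r10, h6, -Nat.mod_mul_mod, h.search_address x]
    rwa [h.field (by omega)]
  · simp [h6]
  · exact ((((((hr.update _ (by decide)).update _ (by decide)).update _ (by decide)).update _
      (by decide)).update _ (by decide)).update _ (by decide)).update _ (by decide)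
  · simp
  · simp [h7, hr.r8]
    exact Op.eval_add_of_lt hj

/-- Induction on the number `d` of rounds left before position `J`, each costing `g + 10`; `B` pays
for what happens once `J` is reached. -/
theorem search (h : Query w n t k L F g T π D) {J : ℕ} (hJ : J < 2 ^ w)
    (hmark : ∀ j < J, T ((π^[j] i : ℕ) / t * 5) ≠ π^[j] i)
    (hi : ∀ j ≤ J, 0 < j → π^[j] i ≠ i)
    (hB : ∀ reg', Ready w k t L i reg' → reg' 6 = (π^[J] i : Fin n) → reg' 7 = J →
      Halts ⟨8, reg', mem⟩ y B) (d : ℕ) :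
    ∀ (j : ℕ) (reg : ℕ → ℕ), j + d = J → Ready w k t L i reg → reg 6 = (π^[j] i : Fin n) →
      reg 7 = j → Halts ⟨8, reg, mem⟩ y (B + d * (g + 10)) := by
  induction d with
  | zero =>
    intro j reg hj hr h6 h7
    obtain rfl : j = J := hj
    simpa using hB reg hr h6 h7
  | succ d ih =>
    intro j reg hj hr h6 h7
    refine (h.search_next (B := B + d * (g + 10) + 1 + 1) hr h6 h7 (hmark j (by omega))
      (by omega) fun reg' hr' h6' h7' => ?_).mono (by rw [add_mul]; omega)
    rw [← iterate_succ_apply' (⇑π)] at h6'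
    refine .jeq_neg rfl ?_ (.jump rfl (ih (j + 1) reg' (by omega) hr' h6' h7'))
    rw [h6', hr'.r0]
    exact fun he => hi (j + 1) (by omega) (by omega) (Fin.ext he)

/-- Both programs compute the reduced power by a remainder and one further instruction. -/
theorem reduce {l pc a : ℕ} (hl : 0 < l) (hlw : l < 2 ^ w) (h1 : reg 1 = k)
    (ha : reg a = l) (ha12 : a ≠ 12) (h20 : reg 20 = 0)
    (hp : (powerProgram neg)[pc]? = some (.op .mod 12 1 a))
    (hp' : (powerProgram neg)[pc + 1]? =
      some (if neg then .op .sub 12 a 12 else .op .add 12 12 20))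
    (hB : ∀ v, Halts ⟨pc + 2, update (update reg 12 v) 12 (reducedPower neg k l), mem⟩ y B) :
    Halts ⟨pc, reg, mem⟩ y (B + 2) := by
  have hm := Nat.mod_lt k hl
  refine .op hp ?_
  cases neg
  · refine .op hp' ?_
    convert hB _ using 3
    simp [h1, ha, h20, Op.eval, reducedPower]
    rw [Nat.mod_eq_of_lt (by omega)]
  · refine .op hp' ?_
    convert hB _ using 3
    simp [h1, ha, ha12, reducedPower]
    rw [show Op.mod.eval w k l = k % l from Nat.mod_eq_of_lt (by omega),
      Op.eval_sub_of_le (by omega) hlw]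

theorem short_cycle (h : Query w n t k L F g T π D) (hr : Ready w k t L i reg) {l : ℕ}
    (hl : 0 < l) (hlw : l < 2 ^ w) (h6 : reg 6 = i) (h7 : reg 7 = l) :
    Halts ⟨18, reg, mem⟩ (π^[reducedPower neg k l] i : Fin n) (l * (g + 4) + 4) := by
  have hle := reducedPower_le (neg := neg) (k := k) hl
  refine reduce hl hlw hr.r1 h7 (by decide) hr.r20 rfl (by cases neg <;> rfl) fun v => ?_
  refine (h.walk _ _ i ?_ ?_ ?_ ?_ (hle.trans_lt hlw)).mono
    (Nat.add_le_add_right (Nat.mul_le_mul_right _ hle) 2)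
  · simp [h6]
  · simp [hr.r8]
  · simp
  · simp [hr.r20]

theorem jump_to_segment (h : Query w n t k L F g T π D) (hr : Ready w k t L i reg) {b q : ℕ}
    (h12 : reg 12 = q) (h15 : reg 15 = b) (hq : q < 2 ^ w)
    (hrow : (b + q / t) * 5 + 4 < F) {s : Fin n} (hs : T ((b + q / t) * 5 + 4) = s) :
    Halts ⟨46, reg, mem⟩ (π^[q % t] s : Fin n) (t * (g + 4) + 12) := by
  have hqt := Nat.mod_lt q h.t_pos
  -- Only the final address is known to fit in a word. Since what follows the division is addition
  -- and multiplication, the intermediate reductions modulo `2 ^ w` can be dropped.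
  have haddr : ((q / t % 2 ^ w + b) % 2 ^ w * 5 % 2 ^ w + 4 % 2 ^ w) % 2 ^ w * L % 2 ^ w =
      ((b + q / t) * 5 + 4) * L := by
    rw [add_comm b]
    simp only [Nat.mod_mul_mod, Nat.mod_add_mod, Nat.add_mod_mod]
    rw [add_comm _ b]
    exact Nat.mod_eq_of_lt (h.address_lt hrow)
  have hmod : q % t < 2 ^ w := (Nat.mod_le q t).trans_lt hq
  refine .op rfl (.op rfl (.op rfl (.op rfl (.const rfl (.op rfl (.op rfl (.read rfl (.op rfl
    (.jump rfl (RunsWithin.mono (B := (q % t) * (g + 4) + 2) ?_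
      (Nat.add_le_add_right (Nat.mul_le_mul_right _ hqt.le) 2)))))))))))
  refine h.walk _ _ s ?_ ?_ ?_ ?_ hmod
  · simp [Op.eval, h12, h15, hr.r3, hr.r4, hr.r5, hr.r10, -Nat.mod_mul_mod, -Nat.mod_add_mod,
      -Nat.add_mod_mod, haddr]
    rw [h.field hrow, hs]
  · simp [hr.r8]
  · simp [Op.eval, h12, hr.r3, Nat.mod_eq_of_lt hmod]
  · simp [hr.r20]

theorem read_next (h : Query w n t k L F g T π D) {pc d f : ℕ}
    (hp : (powerProgram neg)[pc]? = some (.op .add 9 9 4))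
    (hp' : (powerProgram neg)[pc + 1]? = some (.read d 9))
    (hp'' : (powerProgram neg)[pc + 1 + 1]? = some (.op .mod d d 5))
    (hd : d ≠ 0 ∧ d ≠ 1 ∧ d ≠ 3 ∧ d ≠ 4 ∧ d ≠ 5 ∧ d ≠ 8 ∧ d ≠ 10 ∧ d ≠ 20)
    (hr : Ready w k t L i reg) (h9 : reg 9 = f * L) (hf : f + 1 < F)
    (hB : ∀ reg', Ready w k t L i reg' → reg' 9 = (f + 1) * L → reg' d = T (f + 1) →
      (∀ a, a ≠ 9 → a ≠ d → reg' a = reg a) → Halts ⟨pc + 3, reg', mem⟩ y B)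
    (hd9 : d ≠ 9 := by decide) :
    Halts ⟨pc, reg, mem⟩ y (B + 3) := by
  have haddr : (f * L + L) % 2 ^ w = (f + 1) * L := by
    rw [← Nat.succ_mul]
    exact Nat.mod_eq_of_lt (h.address_lt hf)
  refine .op hp (.read hp' (.op hp'' (hB _ (((hr.update _ (by decide)).update _ hd).update _ hd)
    ?_ ?_ fun a ha had => ?_)))
  · simp [Op.eval, h9, hr.r4, hd9.symm, haddr, -Nat.mod_add_mod]
  · simp [Op.eval, h9, hr.r4, hr.r5, hd.2.2.2.2.1.symm, haddr, h.field hf]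
  · simp [ha, had]

theorem read_record (h : Query w n t k L F g T π D) (hr : Ready w k t L i reg) {r j m l b : ℕ}
    (h7 : reg 7 = j) (h9 : reg 9 = r * 5 * L) (hrow : r * 5 + 4 < F) (hm : T (r * 5 + 1) = m)
    (hl : T (r * 5 + 2) = l) (hb : T (r * 5 + 3) = b) (hl0 : 0 < l)
    (hB : ∀ reg', Ready w k t L i reg' → reg' 7 = j → reg' 12 = reducedPower neg k l →
      reg' 13 = m → reg' 14 = l → reg' 15 = b → Halts ⟨36, reg', mem⟩ y B) :
    Halts ⟨25, reg, mem⟩ y (B + 11) := by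
  have hlw : l < 2 ^ w := by
    rw [← hl]
    exact (h.field_lt _).trans_le (Nat.pow_le_pow_right two_pos h.L_le)
  refine h.read_next (B := B + 8) rfl rfl rfl (by decide) hr h9 (by omega)
    fun reg₁ hr₁ h9₁ hv₁ hk₁ => ?_
  refine h.read_next (B := B + 5) rfl rfl rfl (by decide) hr₁ h9₁ (by omega)
    fun reg₂ hr₂ h9₂ hv₂ hk₂ => ?_
  refine h.read_next (B := B + 2) rfl rfl rfl (by decide) hr₂ h9₂ (by omega)
    fun reg₃ hr₃ h9₃ hv₃ hk₃ => ?_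
  have h14 : reg₃ 14 = l := by rw [hk₃ 14 (by decide) (by decide), hv₂, hl]
  refine reduce (k := k) hl0 hlw hr₃.r1 h14 (by decide) hr₃.r20 rfl (by cases neg <;> rfl)
    fun v => hB _ ((hr₃.update _ (by decide)).update _ (by decide)) ?_ ?_ ?_ ?_ ?_
  · simp [hk₃, hk₂, hk₁, h7]
  · simp
  · simp [hk₃, hk₂, hv₁, hm]
  · simp [h14]
  · simp [hv₃, hb]

/-- The mark at position `m` lies `j` steps after `i`, so `i` is at `m - j` modulo `l`. Words cannot
be negative, hence the two cases. -/
theorem start_position (hr : Ready w k t L i reg) {j e m l b : ℕ} (hlw : l < 2 ^ w) (hml : m < l)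
    (hjl : j < l) (h7 : reg 7 = j) (h12 : reg 12 = e) (h13 : reg 13 = m) (h14 : reg 14 = l)
    (h15 : reg 15 = b)
    (hB : ∀ reg' u, Ready w k t L i reg' → u < l → u + j ≡ m [MOD l] → reg' 12 = e →
      reg' 13 = u → reg' 14 = l → reg' 15 = b → Halts ⟨41, reg', mem⟩ y B) :
    Halts ⟨36, reg, mem⟩ y (B + 3) := by
  by_cases hmj : m < j
  · refine .jlt_pos rfl (by rwa [h7, h13]) (.op rfl (.op rfl (hB _ (m + (l - j))
      ((hr.update _ (by decide)).update _ (by decide)) (by omega) ?_ ?_ ?_ ?_ ?_)))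
    · rw [show m + (l - j) + j = m + l by omega]
      exact Nat.add_mod_right m l
    · simp [h12]
    · simp [h7, h13, h14]
      rw [Op.eval_sub_of_le hjl.le hlw, Op.eval_add_of_lt (by omega)]
    · simp [h14]
    · simp [h15]
  · refine .jlt_neg rfl (by rwa [h7, h13]) (.op rfl (.jump rfl (hB _ (m - j)
      (hr.update _ (by decide)) (by omega) ?_ ?_ ?_ ?_ ?_)))
    · rw [Nat.sub_add_cancel (not_lt.1 hmj)]
    · simp [h12]
    · simp [h7, h13]
      rw [Op.eval_sub_of_le (by omega) (by omega)]
    · simp [h14]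
    · simp [h15]

/-- The sum `u + e` may overflow a word. Comparing `e` with `l - u` first decides whether to wrap
around before anything is added. -/
theorem answer_position (hr : Ready w k t L i reg) {u e l b : ℕ} (hlw : l < 2 ^ w) (hul : u < l)
    (hel : e ≤ l) (h12 : reg 12 = e) (h13 : reg 13 = u) (h14 : reg 14 = l) (h15 : reg 15 = b)
    (hB : ∀ reg' q, Ready w k t L i reg' → q < l → q ≡ u + e [MOD l] → reg' 12 = q →
      reg' 15 = b → Halts ⟨46, reg', mem⟩ y B) :
    Halts ⟨41, reg, mem⟩ y (B + 4) := by
  have hsub : Op.sub.eval w l u = l - u := Op.eval_sub_of_le hul.le hlw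
  have hr' := hr.update (d := 16) (l - u) (by decide)
  refine .op rfl ?_
  rw [h13, h14, hsub]
  by_cases heu : e < l - u
  · refine (RunsWithin.jlt_pos rfl (by simpa [h12] using heu) (.op rfl (hB _ (e + u)
      (hr'.update _ (by decide)) (by omega) ?_ ?_ ?_))).mono (Nat.le_succ _)
    · rw [add_comm]
    · simp [h12, h13]
      rw [Op.eval_add_of_lt (by omega)]
    · simp [h15]
  · refine .jlt_neg rfl (by simpa [h12] using heu) (.op rfl (.jump rfl (hB _ (e - (l - u))
      (hr'.update _ (by decide)) (by omega) ?_ ?_ ?_)))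
    · rw [show u + e = e - (l - u) + l by omega]
      exact (Nat.add_mod_right _ l).symm
    · simp [h12]
      rw [Op.eval_sub_of_le (by omega) (by omega)]
    · simp [h15]

theorem long_cycle (h : Query w n t k L F g T π D) (hr : Ready w k t L i reg) {r j m l : ℕ}
    (h7 : reg 7 = j) (h9 : reg 9 = r * 5 * L) (hrow : r * 5 + 4 < F) (hm : T (r * 5 + 1) = m)
    (hl : T (r * 5 + 2) = l) (hml : m < l) (hjl : j < l)
    (hseg : ∀ q < l, (T (r * 5 + 3) + q / t) * 5 + 4 < F ∧ ∃ s : Fin n,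
      T ((T (r * 5 + 3) + q / t) * 5 + 4) = s ∧
        ∀ e, q + j ≡ m + e [MOD l] → π^[q % t] s = π^[e] i) :
    Halts ⟨25, reg, mem⟩ (π^[reducedPower neg k l] i : Fin n) (t * (g + 4) + 30) := by
  have hl0 : 0 < l := by omega
  have hlw : l < 2 ^ w := by
    rw [← hl]
    exact (h.field_lt _).trans_le (Nat.pow_le_pow_right two_pos h.L_le)
  refine h.read_record (B := t * (g + 4) + 12 + 4 + 3) hr h7 h9 hrow hm hl rfl hl0
    fun reg hr h7 h12 h13 h14 h15 =>
    start_position hr hlw hml hjl h7 h12 h13 h14 h15 fun reg u hr hul huj h12 h13 h14 h15 =>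
    answer_position hr hlw hul (reducedPower_le hl0) h12 h13 h14 h15
      fun reg q hr hql hqu h12 h15 => ?_
  obtain ⟨hrow, s, hs, hsi⟩ := hseg q hql
  have hqj : q + j ≡ m + reducedPower neg k l [MOD l] := by
    refine (hqu.add_right j).trans ?_
    rw [add_right_comm]
    exact huj.add_right _
  rw [← hsi _ hqj]
  exact h.jump_to_segment hr h12 h15 (hql.trans hlw) hrow hs

theorem init_ready (hn : 1 < n) (hnw : n < 2 ^ w) (h5 : 5 < 2 ^ w)
    (hL : L = Nat.log 2 n + 1) (hLw : L < 2 ^ w)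
    (hB : ∀ reg mem, Ready w k t L i reg → reg 6 = i → reg 7 = 0 → Halts ⟨8, reg, mem⟩ y B) :
    Halts (init [i, k, n, t]) y (B + 7) := by
  have h1 : 1 % 2 ^ w = 1 := Nat.mod_eq_of_lt (by omega)
  have hlog : Nat.log 2 n % 2 ^ w = Nat.log 2 n := Nat.mod_eq_of_lt (by omega)
  refine .const rfl (.jlt_pos rfl ?_ (.msb rfl (.op rfl (.op rfl (.op rfl (.const rfl
    (hB _ _ ?_ ?_ ?_)))))))
  · simpa [h1] using hn
  · have hadd : Op.add.eval w (Nat.log 2 n) 1 = L := by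
      rw [hL]
      exact Op.eval_add_of_lt (by omega)
    constructor <;> simp [h1, hlog, hadd]
    · simp [Op.eval, Nat.shiftLeft_eq]
    · exact Nat.mod_eq_of_lt h5
  · simp [Op.eval]
    exact Nat.mod_eq_of_lt (i.2.trans hnw)
  · simp

end Query

/-! ### Field layout and complete queries -/

/-- The fields of the index: five tables, interleaved row by row. -/
def interleave (mark pos len base seg : ℕ → ℕ) (f : ℕ) : ℕ :=
  if f % 5 = 0 then mark (f / 5) else if f % 5 = 1 then pos (f / 5)
  else if f % 5 = 2 then len (f / 5) else if f % 5 = 3 then base (f / 5) else seg (f / 5)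

section interleave

variable (mark pos len base seg : ℕ → ℕ) (r : ℕ)

theorem interleave_mark : interleave mark pos len base seg (r * 5) = mark r := by
  simp [interleave]

theorem interleave_pos : interleave mark pos len base seg (r * 5 + 1) = pos r := by
  have h1 : (r * 5 + 1) % 5 = 1 := by omega
  have h2 : (r * 5 + 1) / 5 = r := by omega
  simp [interleave, h1, h2]

theorem interleave_len : interleave mark pos len base seg (r * 5 + 2) = len r := by
  have h1 : (r * 5 + 2) % 5 = 2 := by omega
  have h2 : (r * 5 + 2) / 5 = r := by omega
  simp [interleave, h1, h2]

theorem interleave_base : interleave mark pos len base seg (r * 5 + 3) = base r := by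
  have h1 : (r * 5 + 3) % 5 = 3 := by omega
  have h2 : (r * 5 + 3) / 5 = r := by omega
  simp [interleave, h1, h2]

theorem interleave_seg : interleave mark pos len base seg (r * 5 + 4) = seg r := by
  have h1 : (r * 5 + 4) % 5 = 4 := by omega
  have h2 : (r * 5 + 4) / 5 = r := by omega
  simp [interleave, h1, h2]

end interleave

namespace Query

variable {w n t k L F g : ℕ} {T : ℕ → ℕ} {π : Equiv.Perm (Fin n)} {D : DataStructure}
  {neg : Bool} {i : Fin n}

/-- Bounded runs of the query program on the encoded index. -/
local notation "Halts" => RunsWithin w (encode L F T) (D.Answers w) (powerProgram neg)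

theorem answers_short (h : Query w n t k L F g T π D) (hn : 1 < n) (hL : L = Nat.log 2 n + 1)
    (hLw : L < 2 ^ w) {j : ℕ} (hj : 0 < j) (hji : π^[j] i = i)
    (hmark : ∀ j' < j, T ((π^[j'] i : ℕ) / t * 5) ≠ π^[j'] i)
    (hi : ∀ j' < j, 0 < j' → π^[j'] i ≠ i) :
    Halts (init [i, k, n, t]) (π^[reducedPower neg k j] i : Fin n)
      (j * (g + 4) + j * (g + 10) + 20) := by
  have hjw : j < 2 ^ w := by
    refine lt_of_le_of_lt ?_ h.n_lt
    have hmin : j ≤ minimalPeriod π i := by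
      by_contra hlt
      exact hi _ (not_le.1 hlt) (π.minimalPeriod_pos i) iterate_minimalPeriod
    exact hmin.trans (minimalPeriod_le_card.trans (Fintype.card_fin n).le)
  -- The program tests for a return right after a call, before it looks for a mark again, so the
  -- last round is treated apart from the `J` ordinary ones.
  obtain ⟨J, rfl⟩ : ∃ J, j = J + 1 := ⟨j - 1, by omega⟩
  refine (init_ready (B := (J + 1) * (g + 4) + 4 + 1 + 1 + g + 7 + J * (g + 10)) hn h.n_lt
    h.five_lt hL hLw fun reg mem hr h6 h7 => ?_).mono
    (by rw [add_mul J 1 (g + 10)]; omega)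
  refine h.search (J := J) (by omega) (fun j' hj' => hmark j' (by omega))
    (fun j' hj' => hi j' (by omega)) (fun reg hr h6 h7 => ?_) J 0 reg (by omega) hr h6 h7
  refine h.search_next hr h6 h7 (hmark J (by omega)) hjw fun reg hr h6 h7 => ?_
  rw [← iterate_succ_apply' (⇑π), hji] at h6
  exact .jeq_pos rfl (by rw [h6, hr.r0]) (h.short_cycle hr hj hjw h6 h7)

theorem answers_long (h : Query w n t k L F g T π D) (hn : 1 < n) (hL : L = Nat.log 2 n + 1)
    (hLw : L < 2 ^ w) {j r m l : ℕ}
    (hmark : ∀ j' < j, T ((π^[j'] i : ℕ) / t * 5) ≠ π^[j'] i)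
    (hi : ∀ j' ≤ j, 0 < j' → π^[j'] i ≠ i) (hr : (π^[j] i : ℕ) / t = r)
    (hmarkj : T (r * 5) = (π^[j] i : Fin n)) (hm : T (r * 5 + 1) = m)
    (hl : T (r * 5 + 2) = l) (hml : m < l) (hjl : j < l)
    (hseg : ∀ q < l, (T (r * 5 + 3) + q / t) * 5 + 4 < F ∧ ∃ s : Fin n,
      T ((T (r * 5 + 3) + q / t) * 5 + 4) = s ∧
        ∀ e, q + j ≡ m + e [MOD l] → π^[q % t] s = π^[e] i) :
    Halts (init [i, k, n, t]) (π^[reducedPower neg k l] i : Fin n)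
      (t * (g + 4) + j * (g + 10) + 43) := by
  have hlw : l < 2 ^ w := by
    rw [← hl]
    exact (h.field_lt _).trans_le (Nat.pow_le_pow_right two_pos h.L_le)
  subst hr
  refine (init_ready (B := t * (g + 4) + 30 + 6 + j * (g + 10)) hn h.n_lt
    h.five_lt hL hLw fun reg mem hr h6 h7 => ?_).mono (by omega)
  refine h.search (by omega) hmark hi (fun reg hr h6 h7 => ?_) j 0 reg (by omega) hr h6 h7
  exact h.search_mark hr h6 h7 hmarkj fun reg hr h7 h9 =>
    h.long_cycle hr h7 h9 (h.row_lt _ (Fin.is_lt _)) hm hl hml hjl hseg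

end Query

/-! ### Size of the index and assembly -/

theorem SupportsPerm.pos {D : DataStructure} {w n g : ℕ} {π : Equiv.Perm (Fin n)} (i : Fin n)
    (h : D.SupportsPerm w π g) : 0 < g :=
  let ⟨_, hs, hr⟩ := h i
  hr.pos.trans_le hs

/-- From `1 ≤ n / t` there are at most `3 * (n / t)` rows, and from `1 ≤ lg n` at most `2 * lg n`
bits per entry; five entries per row give 30. -/
theorem length_index_le {n t : ℕ} (ht : 1 ≤ t) (htn : t ≤ n) (hn : 1 < n) :
    (((2 * n / t + 1) * 5 * (Nat.log 2 n + 1) : ℕ) : ℝ) ≤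
      30 * ((n : ℝ) / t * Real.logb 2 n) := by
  have ht' : (0 : ℝ) < t := by exact_mod_cast ht
  have h1 : (1 : ℝ) ≤ n / t := by
    rw [one_le_div ht']
    exact_mod_cast htn
  have h2 : ((2 * n / t : ℕ) : ℝ) ≤ 2 * (n / t) := by
    refine (Nat.cast_div_le).trans (le_of_eq ?_)
    push_cast
    ring
  have h3 : (1 : ℝ) ≤ Real.logb 2 n := by
    rw [Real.le_logb_iff_rpow_le one_lt_two (by positivity)]
    simpa using (by exact_mod_cast hn : (2 : ℝ) ≤ n)
  have h4 : (Nat.log 2 n : ℝ) ≤ Real.logb 2 n := by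
    simpa using Real.natLog_le_logb n 2
  push_cast
  calc (((2 * n / t : ℕ) : ℝ) + 1) * 5 * ((Nat.log 2 n : ℝ) + 1)
      ≤ (3 * (n / t)) * 5 * (2 * Real.logb 2 n) := by gcongr <;> linarith
    _ = _ := by ring

/-- For `n = 1` the bound `lg n = 0` leaves no bits at all, so the programs answer without reading
the index. -/
theorem answersWith_one {neg : Bool} {w k t : ℕ} (h : 1 < 2 ^ w) (I : List Bool)
    (D : DataStructure) (i y : Fin 1) :
    AnswersWith (powerProgram neg) w I D [i, k, 1, t] y 3 := by
  refine RunsWithin.const rfl (.jlt_neg rfl ?_ (.halt rfl ?_))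
  · simp [Nat.mod_eq_of_lt h]
  · simp

/-- The index allows both query programs to find the number of steps to be made. -/
theorem exists_index {n t : ℕ} (π : Equiv.Perm (Fin n)) (ht : 1 ≤ t) (htn : t ≤ n) (hn : 1 < n) :
    ∃ I : List Bool, (I.length : ℝ) ≤ 30 * ((n : ℝ) / t * Real.logb 2 n) ∧
      ∀ w, n < 2 ^ w → I.length ≤ 2 ^ w → ∀ (D : DataStructure) (g : ℕ), D.SupportsPerm w π g →
        ∀ k < 2 ^ w, ∀ (i : Fin n) (neg : Bool), ∃ l > 0, IsPeriodicPt π l i ∧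
          AnswersWith (powerProgram neg) w I D [i, k, n, t] (π^[reducedPower neg k l] i : Fin n)
            (100 * (t * g)) := by
  obtain ⟨mark, pos, len, base, seg, hle, htab⟩ := π.exists_tables (t := t) ht
  refine ⟨encode (Nat.log 2 n + 1) ((2 * n / t + 1) * 5) (interleave mark pos len base seg),
    ?_, ?_⟩
  · rw [length_encode]
    exact length_index_le ht htn hn
  intro w hnw hIw D g hD k hk i neg
  rw [length_encode] at hIw
  have hg : 0 < g := SupportsPerm.pos i hD
  have hLlt : Nat.log 2 n < w := Nat.log_lt_of_lt_pow (by omega) hnw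
  have h2 : 2 ≤ 2 * n / t := by
    rw [Nat.le_div_iff_mul_le ht]
    omega
  -- The index has at least 15 bits, because `2 * n / t ≥ 2`, and its length is at most `2 ^ w`.
  have h5 : 5 < 2 ^ w := by nlinarith
  have hq : Query w n t k (Nat.log 2 n + 1) ((2 * n / t + 1) * 5) g
      (interleave mark pos len base seg) π D := by
    refine ⟨ht, hnw, hk, Nat.succ_pos _, hLlt, hIw, h5, fun f => ?_, fun x hx => ?_, hD⟩
    · refine lt_of_le_of_lt ?_ (Nat.lt_pow_succ_log_self one_lt_two n)
      have := hle (f / 5)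
      unfold interleave
      split_ifs <;> omega
    · have : x / t ≤ 2 * n / t := Nat.div_le_div_right (by omega)
      omega
  have hLw : Nat.log 2 n + 1 < 2 ^ w := lt_of_le_of_lt hLlt Nat.lt_two_pow_self
  have htg : t ≤ t * g := Nat.le_mul_of_pos_right t hg
  obtain ⟨j, hj, hmark, hi, ⟨hj0, hji⟩ |
    ⟨hji, r, m, l, hr, hmarkj, hm, hl, hml, hjl, hper, hseg⟩⟩ := htab i
  · refine ⟨j, hj0, hji, (hq.answers_short hn rfl hLw hj0 hji
      (fun j' h => by rw [interleave_mark]; exact hmark j' h) hi).mono ?_⟩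
    have : j * g ≤ 3 * t * g := Nat.mul_le_mul_right g hj
    nlinarith
  · refine ⟨l, by omega, hper, (hq.answers_long (j := j) (r := r) (m := m) hn rfl hLw
      (fun j' h => by rw [interleave_mark]; exact hmark j' h) ?_ hr ?_ ?_ ?_ hml hjl ?_).mono ?_⟩
    · intro j' hj' h0
      rcases hj'.eq_or_lt with rfl | h
      · exact hji h0
      · exact hi j' h h0
    · rw [interleave_mark, hmarkj]
    · rw [interleave_pos, hm]
    · rw [interleave_len, hl]
    · intro q hql
      obtain ⟨h1, s, hs, h2⟩ := hseg q hql
      rw [interleave_base, interleave_seg]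
      exact ⟨by omega, s, hs, h2⟩
    · have : j * g ≤ 3 * t * g := Nat.mul_le_mul_right g hj
      nlinarith

end WordRAM

theorem theorem8 :
    ∃ (P Q : WordRAM.Program) (C : ℕ),
      ∀ (n t : ℕ) (π : Equiv.Perm (Fin n)), 1 ≤ t → t ≤ n →
        ∃ I : List Bool,
          (I.length : ℝ) ≤ C * ((n : ℝ) / (t : ℝ) * Real.logb 2 (n : ℝ)) ∧
          ∀ w : ℕ, n < 2 ^ w → I.length ≤ 2 ^ w →
            ∀ (D : WordRAM.DataStructure) (g : ℕ), D.SupportsPerm w π g →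
              ∀ k : ℕ, k < 2 ^ w → ∀ i : Fin n,
                WordRAM.AnswersWith P w I D [(i : ℕ), k, n, t]
                  (((π ^ k) i : Fin n) : ℕ) (C * (t * g)) ∧
                WordRAM.AnswersWith Q w I D [(i : ℕ), k, n, t]
                  (((π ^ (-(k : ℤ))) i : Fin n) : ℕ) (C * (t * g)) := by
  -- One constant serves for space, where 30 suffices, and for time: with `j ≤ 3 * t` and `1 ≤ t ≤ t
  -- * g` both kinds of query stay below `100 * (t * g)`.
  refine ⟨WordRAM.powerProgram false, WordRAM.powerProgram true, 100, fun n t π ht htn => ?_⟩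
  rcases (ht.trans htn).eq_or_lt with rfl | hn
  · refine ⟨[], by simp, fun w hnw _ D g hD k _ i => ?_⟩
    have htg : 0 < t * g := Nat.mul_pos ht (WordRAM.SupportsPerm.pos i hD)
    exact ⟨WordRAM.RunsWithin.mono (WordRAM.answersWith_one hnw _ D i _) (by omega),
      WordRAM.RunsWithin.mono (WordRAM.answersWith_one hnw _ D i _) (by omega)⟩
  · obtain ⟨I, hI, hrun⟩ := WordRAM.exists_index π ht htn hn
    refine ⟨I, hI.trans ?_, fun w hnw hIw D g hD k hk i => ⟨?_, ?_⟩⟩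
    · push_cast
      have : 0 ≤ Real.logb 2 (n : ℝ) :=
        Real.logb_nonneg one_lt_two (by exact_mod_cast hn.le)
      gcongr
      norm_num
    · obtain ⟨l, _, hper, h⟩ := hrun w hnw hIw D g hD k hk i false
      rwa [WordRAM.iterate_reducedPower_false hper] at h
    · obtain ⟨l, hl, hper, h⟩ := hrun w hnw hIw D g hD k hk i true
      rwa [WordRAM.iterate_reducedPower_true hl hper] at h
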